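/- Let $R$ be a Noetherian normal domain with $\dim R\ge 2$. For a homomorphism $\psi:R^{n}\to R^{m}$ let $I_t(\psi)$ be the ideal of $R$ generated by the $t$-minors of the matrix of $\psi$ (so $I_0(\psi)=R$); the unit ideal has height $\infty$. Let $N$ be an $R$-module of rank $s$ with a finite free presentation $R^{\beta_1}\xrightarrow{\psi}R^{\beta_0}\to N\to 0$. (a) If $N$ is torsionfree, then $\operatorname{height} I_{\beta_0-s}(\psi)\ge 2$. (b) Suppose that there is an exact sequence $0\to R^{t}\to M\to N\to 0$, for some $t\ge 0$, with $M$ a torsionfree $R$-module of finite projective dimension. If $\operatorname{height} I_{\beta_0-s}(\psi)\ge 2$, then $N$ is torsionfree. Corollary. Let $M$ be a finitely generated torsionfree $R$-module of rank $r>1$ and of finite projective dimension, let $\varphi:R^{r-1}\to M$ be an injective homomorphism, and let $R^{\beta_1}\xrightarrow{\psi}R^{\beta_0}\to\operatorname{Coker}\varphi\to 0$ be a presentation. Then $\operatorname{Coker}\varphi$ is torsionfree if and only if $\operatorname{height} I_{\beta_0-1}(\psi)\ge 2$. Moreover, the same condition is equivalent to $0\to R^{r-1}\xrightarrow{\varphi}M\to\operatorname{Coker}\varphi\to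 0$ being a Bourbaki sequence, i.e. to $\operatorname{Coker}\varphi$ being isomorphic to an ideal of $R$. -/

import Mathlib

universe u

/-- The ideal `I_t(ψ)` generated by the `t`-minors of the matrix representing a homomorphism
`ψ : R^n → R^m` in the standard bases. The rows and columns are chosen by arbitrary maps: a repeated
row or column gives the determinant `0`, a reordering changes the sign only, so the ideal is the one
generated by the honest minors. In particular `I_0(ψ) = R`, and `I_t(ψ) = 0` for `t > min m n`. -/
def minorsIdeal {R : Type u} [CommRing R] {n m : ℕ} (t : ℕ)
    (ψ : (Fin n → R) →ₗ[R] (Fin m → R)) : Ideal R :=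
  Ideal.span {d : R | ∃ (a : Fin t → Fin m) (b : Fin t → Fin n),
    d = ((LinearMap.toMatrix' ψ).submatrix a b).det}

/-- The sequence `0 → F → M → C → 0` with maps `f` and `g` is a Bourbaki sequence of `M`: it is
exact, `F` is free, and `C` is (isomorphic to) an ideal of `R`. -/
structure IsBourbakiSequence {R : Type u} [CommRing R] {F M C : Type u}
    [AddCommGroup F] [Module R F] [AddCommGroup M] [Module R M] [AddCommGroup C] [Module R C]
    (f : F →ₗ[R] M) (g : M →ₗ[R] C) : Prop where
  free : Module.Free R F
  injective : Function.Injective f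
  exact : Function.Exact f g
  surjective : Function.Surjective g
  iso_ideal : ∃ I : Ideal R, Nonempty (C ≃ₗ[R] I)

/-- The projective dimension of the `R`-module `M` is finite (the zero module included). -/
def HasFiniteProjDim (R : Type u) [CommRing R] (M : Type u) [AddCommGroup M] [Module R M] : Prop :=
  CategoryTheory.projectiveDimension (ModuleCat.of R M) < ⊤

/-! The image of `ψ` has rank `k = β₀ - s`. If `N` is torsion-free, that image is saturated. At a
prime of height at most one the localization is a field or a DVR, where a saturated image stays of
rank `k` modulo the maximal ideal, so some `k`-minor is a unit and the prime does not contain `I_k`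
(`two_le_height_minorsIdeal`). Conversely, by Cramer's rule the `k`-minors kill the torsion of `N`
(`minorsIdeal_le_torsionOf`), so a torsion element has annihilator of height at least two. By
normality such an element lifts into the free submodule of `M`, hence is zero
(`eq_zero_of_two_le_height_torsionOf`). In the corollary the cokernel has rank one, and for it
torsion-free means isomorphic to an ideal. -/

/-! ### Minors over fields and local principal ideal domains -/

/-- A matrix over a field whose rank is at least `k` has `k` linearly independent columns. -/
theorem Matrix.exists_linearIndependent_cols_of_le_rank {K m n : Type*} [Field K] [Fintype m]
    [Fintype n] (A : Matrix m n K) {k : ℕ} (hk : k ≤ A.rank) :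
    ∃ b : Fin k → n, LinearIndependent K (A.submatrix id b).col := by
  rw [Matrix.rank_eq_finrank_span_cols] at hk
  obtain ⟨f, hf, -, hli⟩ := Submodule.exists_fun_fin_finrank_span_eq K (Set.range A.col)
  choose b hb using hf
  refine ⟨fun i => b (Fin.castLE hk i), ?_⟩
  obtain rfl : f = fun i => A.col (b i) := funext fun i => (hb i).symm
  exact hli.comp (Fin.castLE hk) (Fin.castLE_injective hk)

/-- A matrix over a field whose rank is at least `k` has a nonzero minor of size `k`. -/
theorem Matrix.exists_submatrix_det_ne_zero_of_le_rank {K m n : Type*} [Field K] [Fintype m]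
    [Fintype n] (A : Matrix m n K) {k : ℕ} (hk : k ≤ A.rank) :
    ∃ (a : Fin k → m) (b : Fin k → n), (A.submatrix a b).det ≠ 0 := by
  obtain ⟨b, hb⟩ := A.exists_linearIndependent_cols_of_le_rank hk
  have hrank : k ≤ (A.submatrix id b).transpose.rank := by
    rw [Matrix.rank_transpose, Matrix.rank_eq_finrank_span_cols, finrank_span_eq_card hb,
      Fintype.card_fin]
  obtain ⟨a, ha⟩ := Matrix.exists_linearIndependent_cols_of_le_rank _ hrank
  refine ⟨a, b, ?_⟩
  have := (Matrix.isUnit_iff_isUnit_det _).mp (Matrix.linearIndependent_cols_iff_isUnit.mp ha)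
  rw [← Matrix.det_transpose]
  exact this.ne_zero

/-- Over a local principal ideal domain, a matrix whose column space is saturated and contains `k`
linearly independent vectors has an invertible minor of size `k`. -/
theorem Matrix.exists_isUnit_det_submatrix_of_saturated {A m n : Type*} [CommRing A] [IsDomain A]
    [IsLocalRing A] [IsPrincipalIdealRing A] [Fintype m] [Fintype n] (X : Matrix m n A)
    (hsat : ∀ (c : A) (y : m → A), c ≠ 0 → c • y ∈ LinearMap.range X.mulVecLin →
      y ∈ LinearMap.range X.mulVecLin)
    {k : ℕ} (v : Fin k → LinearMap.range X.mulVecLin) (hv : LinearIndependent A v) :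
    ∃ (a : Fin k → m) (b : Fin k → n), IsUnit (X.submatrix a b).det := by
  classical
  set L := LinearMap.range X.mulVecLin
  have hk : k ≤ Module.finrank A L := by simpa using hv.fintype_card_le_finrank
  let B : Module.Basis (Fin (Module.finrank A L)) A L := Module.finBasis A L
  choose w hw using fun i => (B i).2
  obtain ⟨t, ht⟩ := (IsPrincipalIdealRing.principal (IsLocalRing.maximalIdeal A)).principal
  let ρ := IsLocalRing.residue A
  -- A relation modulo `t` lifts to a combination `t • y`; saturation puts `y` in `L`, so `t`
  -- divides every coefficient.
  have hli : LinearIndependent (IsLocalRing.ResidueField A)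
      (fun i => (ρ ∘ (B i : m → A) : m → IsLocalRing.ResidueField A)) := by
    rw [Fintype.linearIndependent_iff]
    intro g hg i
    choose c hc using fun i => IsLocalRing.residue_surjective (g i)
    have hmem : ∀ j, (∑ i, c i • (B i : m → A)) j ∈ IsLocalRing.maximalIdeal A := by
      intro j
      rw [← IsLocalRing.residue_eq_zero_iff]
      have := congrFun hg j
      simpa [Finset.sum_apply, map_sum, hc, ρ] using this
    have hy : ∀ j, ∃ y, y * t = (∑ i, c i • (B i : m → A)) j := fun j => by
      have := hmem j
      rw [ht] at this
      exact Submodule.mem_span_singleton.mp this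
    choose y hy using hy
    have hty : t • y = ∑ i, c i • (B i : m → A) := by
      ext j; rw [← hy j, Pi.smul_apply, smul_eq_mul, mul_comm]
    have hdvd : ∃ d : Fin (Module.finrank A L) → A, ∀ i, c i = t * d i := by
      -- Here `A` is a field.
      by_cases ht0 : t = 0
      · refine ⟨0, fun i => ?_⟩
        have h0 : ∑ i, c i • B i = 0 := by
          apply Subtype.ext; simp [← hty, ht0]
        simpa using Fintype.linearIndependent_iff.mp B.linearIndependent c h0 i
      · have hyL : y ∈ L := by
          refine hsat t y ht0 ?_
          rw [hty]
          exact L.sum_mem fun i _ => L.smul_mem _ (B i).2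
        refine ⟨fun i => B.repr ⟨y, hyL⟩ i, fun i => ?_⟩
        have h1 : ∑ i, c i • B i = t • (⟨y, hyL⟩ : L) := by
          apply Subtype.ext; simp [← hty]
        have h2 := congrArg (fun x => B.repr x i) h1
        rw [B.repr_sum_self] at h2
        rw [h2, map_smul, Finsupp.smul_apply, smul_eq_mul]
    obtain ⟨d, hd⟩ := hdvd
    rw [← hc i, hd i, IsLocalRing.residue_eq_zero_iff, ht]
    exact Ideal.mul_mem_right _ _ (Submodule.mem_span_singleton_self t)
  have hrank : k ≤ (X.map ρ).rank := by
    refine hk.trans ?_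
    have hmem : ∀ i, (ρ ∘ (B i : m → A)) ∈ LinearMap.range (X.map ρ).mulVecLin := fun i => by
      refine ⟨ρ ∘ w i, ?_⟩
      rw [← hw i]
      ext j
      simp [Matrix.mulVec, dotProduct, map_sum]
    let u : Fin (Module.finrank A L) → LinearMap.range (X.map ρ).mulVecLin :=
      fun i => ⟨_, hmem i⟩
    have hu : LinearIndependent (IsLocalRing.ResidueField A) u :=
      LinearIndependent.of_comp (LinearMap.range (X.map ρ).mulVecLin).subtype hli
    simpa [Matrix.rank] using hu.fintype_card_le_finrank
  obtain ⟨a, b, hab⟩ := Matrix.exists_submatrix_det_ne_zero_of_le_rank _ hrank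
  refine ⟨a, b, ?_⟩
  rw [← IsLocalRing.residue_ne_zero_iff_isUnit]
  change ρ _ ≠ 0
  rw [RingHom.map_det]
  exact hab

/-! ### Heights one and two in normal domains -/

/-- A localization of a Noetherian normal domain at a prime of height at most one is a principal
ideal domain. -/
theorem Ideal.isPrincipalIdealRing_localization_of_height_le_one {R : Type*} [CommRing R]
    [IsDomain R] [IsNoetherianRing R] [IsIntegrallyClosed R] (p : Ideal R) [p.IsPrime]
    (hp : p.height ≤ 1) : IsPrincipalIdealRing (Localization.AtPrime p) := by
  have hdom : IsDomain (Localization.AtPrime p) :=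
    IsLocalization.isDomain_localization p.primeCompl_le_nonZeroDivisors
  have hnoeth : IsNoetherianRing (Localization.AtPrime p) :=
    IsLocalization.isNoetherianRing p.primeCompl _ inferInstance
  have htfae : IsPrincipalIdealRing (Localization.AtPrime p) ↔
      IsIntegrallyClosed (Localization.AtPrime p) ∧ ∀ P : Ideal (Localization.AtPrime p),
        P ≠ ⊥ → P.IsPrime → P = IsLocalRing.maximalIdeal (Localization.AtPrime p) :=
    (tfae_of_isNoetherianRing_of_isLocalRing_of_isDomain (Localization.AtPrime p)).out 0 3
  refine htfae.mpr ⟨?_, fun P hP hP' => ?_⟩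
  · exact isIntegrallyClosed_of_isLocalization _ p.primeCompl p.primeCompl_le_nonZeroDivisors
  · have hdim := IsLocalization.AtPrime.ringKrullDim_eq_height p (Localization.AtPrime p)
    by_contra hne
    have hlt : P < IsLocalRing.maximalIdeal (Localization.AtPrime p) :=
      lt_of_le_of_ne (IsLocalRing.le_maximalIdeal hP'.ne_top) hne
    have h1 := Ideal.height_add_one_le_of_lt_of_isPrime hlt
    have h2 : (IsLocalRing.maximalIdeal (Localization.AtPrime p)).height ≤ 1 := by
      have := IsLocalRing.maximalIdeal_height_eq_ringKrullDim (R := Localization.AtPrime p)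
      rw [hdim] at this
      exact (WithBot.coe_inj.mp this).le.trans hp
    have h3 : P.height ≠ 0 := fun h => hP (Ideal.height_eq_zero_iff_eq_bot.mp h)
    have h4 : 1 ≤ P.height := Order.one_le_iff_ne_zero.mpr h3
    have h5 : (2 : ℕ∞) ≤ 1 := by
      calc (2 : ℕ∞) = 1 + 1 := by norm_num
        _ ≤ P.height + 1 := by gcongr
        _ ≤ 1 := h1.trans h2
    exact absurd h5 (by norm_num)

/-- Over a Noetherian normal domain, a fraction `c / a` multiplied into the ring by an ideal of
height at least two lies in the ring. -/
theorem IsIntegrallyClosed.dvd_of_two_le_height {R : Type*} [CommRing R] [IsDomain R]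
    [IsNoetherianRing R] [IsIntegrallyClosed R] {J : Ideal R} (hJ : 2 ≤ J.height) {a c : R}
    (h : ∀ x ∈ J, a ∣ x * c) : a ∣ c := by
  by_cases ha : a = 0
  · subst ha
    by_contra hc
    have hJ0 : J = ⊥ := (Submodule.eq_bot_iff _).mpr fun x hx => by
      have := h x hx
      rw [zero_dvd_iff] at this hc
      exact (mul_eq_zero.mp this).resolve_right hc
    rw [hJ0, Ideal.height_bot] at hJ
    exact absurd hJ (by norm_num)
  by_contra hac
  have hc : (Ideal.Quotient.mk (Ideal.span {a}) c) ≠ 0 := fun h0 =>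
    hac (Ideal.mem_span_singleton.mp (Ideal.Quotient.eq_zero_iff_mem.mp h0))
  obtain ⟨p, hp, hle⟩ := exists_le_isAssociatedPrime_of_isNoetherianRing R _ hc
  have hprime : p.IsPrime := hp.isPrime
  obtain ⟨-, z, hz⟩ := isAssociatedPrime_iff.mp hp
  obtain ⟨d, rfl⟩ := Ideal.Quotient.mk_surjective z
  have hmem : ∀ (d x : R), x ∈ (⊥ : Submodule R (R ⧸ Ideal.span {a})).colon
      {Ideal.Quotient.mk (Ideal.span {a}) d} ↔ a ∣ x * d := by
    intro d x
    rw [Submodule.mem_colon_singleton, Submodule.mem_bot, ← Ideal.mem_span_singleton,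
      ← Ideal.Quotient.eq_zero_iff_mem, map_mul]
    rfl
  have hpd : ∀ x, x ∈ p ↔ a ∣ x * d := fun x => by rw [hz, hmem]
  have hJp : J ≤ p := fun x hx => hle ((hmem c x).mpr (h x hx))
  have hap : a ∈ p := (hpd a).mpr (dvd_mul_right a d)
  have h2 : 2 ≤ p.height := hJ.trans (Ideal.height_mono hJp)
  -- Here `p = (a : d)`, so `(d/a)p ⊆ R`. If `(d/a)p ⊆ p`, then `d/a` is integral, hence in `R`, and
  -- `p = R`. Otherwise `p` is minimal over a principal ideal, and Krull's theorem bounds its height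
  -- by one.
  by_cases hstab : ∀ x ∈ p, ∀ y, x * d = a * y → y ∈ p
  · let K := FractionRing R
    have haK : algebraMap R K a ≠ 0 := by simpa using ha
    have hint : IsIntegral R (algebraMap R K d / algebraMap R K a) := by
      refine isIntegral_of_smul_mem_submodule (M := K)
        (Submodule.map (Algebra.linearMap R K) p) ?_ ?_ _ ?_
      · intro hbot
        have : algebraMap R K a ∈ Submodule.map (Algebra.linearMap R K) p := ⟨a, hap, rfl⟩
        rw [hbot] at this
        exact haK this
      · exact (IsNoetherian.noetherian p).map _
      · rintro _ ⟨x, hx, rfl⟩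
        obtain ⟨y, hy⟩ := (hpd x).mp hx
        refine ⟨y, hstab x hx y hy, ?_⟩
        have := congrArg (algebraMap R K) hy
        rw [map_mul, map_mul] at this
        rw [Algebra.linearMap_apply, Algebra.linearMap_apply, smul_eq_mul]
        rw [div_mul_eq_mul_div, eq_div_iff haK]
        linear_combination -this
    obtain ⟨y, hy⟩ := IsIntegrallyClosed.isIntegral_iff.mp hint
    refine hprime.ne_top ((Ideal.eq_top_iff_one _).mpr ((hpd 1).mpr ⟨y, ?_⟩))
    apply IsFractionRing.injective R K
    rw [map_mul, map_mul, hy, map_one, one_mul, mul_div_cancel₀ _ haK]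
  · push Not at hstab
    obtain ⟨x, hx, y, hxy, hyp⟩ := hstab
    have hd : d ≠ 0 := by
      rintro rfl
      exact hprime.ne_top ((Ideal.eq_top_iff_one _).mpr ((hpd 1).mpr (by simp)))
    have hmin : p ∈ (Ideal.span {x}).minimalPrimes := by
      refine ⟨⟨hprime, by simpa [Ideal.span_singleton_le_iff_mem] using hx⟩, ?_⟩
      rintro q ⟨hq, hxq⟩ hqp r hr
      obtain ⟨e, he⟩ := (hpd r).mp hr
      have hry : r * y = x * e := by
        apply mul_left_cancel₀ (mul_ne_zero ha hd)
        linear_combination (-r * d) * hxy + x * d * he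
      have : r * y ∈ q := by
        rw [hry]
        exact q.mul_mem_right _ (hxq (Ideal.mem_span_singleton_self x))
      exact (hq.mem_or_mem this).resolve_right fun hy => hyp (hqp hy)
    have := Ideal.height_le_one_of_isPrincipal_of_mem_minimalPrimes _ p hmin
    exact absurd (h2.trans this) (by norm_num)

/-- An extension of `N` by a finite free module over a Noetherian normal domain: if the middle term
is torsion-free, then every torsion element of `N` whose annihilator has height at least two
vanishes. -/
theorem eq_zero_of_two_le_height_torsionOf {R : Type*} [CommRing R] [IsDomain R]
    [IsNoetherianRing R] [IsIntegrallyClosed R] {ι M N : Type*} [AddCommGroup M]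
    [Module R M] [AddCommGroup N] [Module R N] [Module.IsTorsionFree R M]
    {φ : (ι → R) →ₗ[R] M} {g : M →ₗ[R] N} (hφ : Function.Injective φ) (hex : Function.Exact φ g)
    (hg : Function.Surjective g) {x : N} (hx : 2 ≤ (Ideal.torsionOf R N x).height) : x = 0 := by
  obtain ⟨m, rfl⟩ := hg x
  have hlift : ∀ a : Ideal.torsionOf R N (g m), ∃ v, φ v = (a : R) • m := fun a =>
    (hex _).mp (by rw [map_smul]; exact (Ideal.mem_torsionOf_iff _ _).mp a.2)
  choose v hv using hlift
  have hcomm : ∀ a b : Ideal.torsionOf R N (g m), (a : R) • v b = (b : R) • v a := fun a b => by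
    apply hφ
    rw [map_smul, map_smul, hv, hv, smul_comm]
  have hne : Ideal.torsionOf R N (g m) ≠ ⊥ := by
    intro h
    rw [h, Ideal.height_bot] at hx
    exact absurd hx (by norm_num)
  obtain ⟨a, haJ, ha⟩ := Submodule.exists_mem_ne_zero_of_ne_bot hne
  -- By `hcomm` the fraction `v a / a` does not depend on `a`, so the whole annihilator multiplies
  -- each of its coordinates into `R`.
  have hdvd : ∀ i, a ∣ v ⟨a, haJ⟩ i := fun i => by
    refine IsIntegrallyClosed.dvd_of_two_le_height hx fun y hy => ⟨v ⟨y, hy⟩ i, ?_⟩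
    exact congrFun (hcomm ⟨y, hy⟩ ⟨a, haJ⟩) i
  choose w hw using hdvd
  have hm : m = φ w := by
    apply smul_right_injective M ha
    change a • m = a • φ w
    rw [← map_smul, ← hv ⟨a, haJ⟩]
    congr 1
    ext i
    exact hw i
  rw [hm]
  exact hex.apply_apply_eq_zero w

/-! ### Rank and torsion of a cokernel -/

/-- The rank of the image of a free presentation. -/
theorem finrank_range_of_exact {R : Type*} [CommRing R] [IsDomain R] {n m : ℕ} {N : Type*}
    [AddCommGroup N] [Module R N] {ψ : (Fin n → R) →ₗ[R] (Fin m → R)} {π : (Fin m → R) →ₗ[R] N}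
    (hex : Function.Exact ψ π) (hπ : Function.Surjective π) :
    Module.finrank R (LinearMap.range ψ) = m - Module.finrank R N := by
  have h1 := (LinearMap.ker π).finrank_quotient_add_finrank
  rw [(π.quotKerEquivOfSurjective hπ).finrank_eq, hex.linearMap_ker_eq,
    Module.finrank_fin_fun] at h1
  -- `h1` gives rank `N` + rank of the image = `m`, so the subtraction does not truncate.
  omega

/-- The minors of `ψ` whose size is the rank of `ψ` annihilate the torsion of the cokernel. -/
theorem minorsIdeal_le_torsionOf {R : Type u} [CommRing R] [IsDomain R] [IsNoetherianRing R] {n m k : ℕ}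
    {N : Type*} [AddCommGroup N] [Module R N] {ψ : (Fin n → R) →ₗ[R] (Fin m → R)}
    {π : (Fin m → R) →ₗ[R] N} (hex : Function.Exact ψ π) (hπ : Function.Surjective π)
    (hk : Module.finrank R (LinearMap.range ψ) = k) {c : R} (hc : c ≠ 0) {x : N}
    (hcx : c • x = 0) : minorsIdeal k ψ ≤ Ideal.torsionOf R N x := by
  refine Ideal.span_le.mpr ?_
  rintro _ ⟨a, b, rfl⟩
  set X := LinearMap.toMatrix' ψ with hX
  set δ := (X.submatrix a b).det with hδ
  rw [SetLike.mem_coe, Ideal.mem_torsionOf_iff]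
  by_cases hδ0 : δ = 0
  · rw [hδ0, zero_smul]
  obtain ⟨y, rfl⟩ := hπ x
  -- `P` keeps the rows `a` and `E` inserts the columns `b`: `P ∘ ψ ∘ E` is the chosen submatrix.
  let P : (LinearMap.range ψ) →ₗ[R] (Fin k → R) :=
    LinearMap.funLeft R R a ∘ₗ (LinearMap.range ψ).subtype
  let E : (Fin k → R) →ₗ[R] (Fin n → R) := Fintype.linearCombination R (fun i => Pi.single (b i) 1)
  have hPE : ∀ z, P ⟨ψ (E z), ⟨E z, rfl⟩⟩ = (X.submatrix a b).mulVec z := by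
    intro z
    ext i
    change ψ (E z) (a i) = _
    simp only [E, Fintype.linearCombination_apply, map_sum, map_smul, Finset.sum_apply,
      Pi.smul_apply, Matrix.mulVec, dotProduct, Matrix.submatrix_apply, hX,
      LinearMap.toMatrix'_apply, smul_eq_mul]
    exact Finset.sum_congr rfl fun j _ => by rw [mul_comm]
  have hPadj : ∀ z : Fin k → R,
      P ⟨ψ (E ((X.submatrix a b).adjugate.mulVec z)), ⟨_, rfl⟩⟩ = δ • z := by
    intro z
    rw [hPE, Matrix.mulVec_mulVec, Matrix.mul_adjugate, Matrix.smul_mulVec, Matrix.one_mulVec]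
  have hrange : k ≤ Module.finrank R (LinearMap.range P) := by
    let Q : (Fin k → R) →ₗ[R] LinearMap.range P :=
      LinearMap.codRestrict _ (δ • LinearMap.id) fun z => ⟨_, hPadj z⟩
    have hQ : Function.Injective Q := fun z z' h => by
      have := congrArg Subtype.val h
      exact smul_right_injective (Fin k → R) hδ0 this
    simpa using LinearMap.finrank_le_finrank_of_injective hQ
  -- Source and image of `P` both have rank `k`, and a torsion-free kernel of rank zero vanishes.
  have hker : LinearMap.ker P = ⊥ := by
    have h1 := (LinearMap.ker P).finrank_quotient_add_finrank
    rw [P.quotKerEquivRange.finrank_eq, hk] at h1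
    have h2 : Module.finrank R (LinearMap.ker P) = 0 := by omega
    exact (Submodule.subsingleton_iff_eq_bot).mp (Module.finrank_zero_iff.mp h2)
  -- By Cramer's rule `ψ (E z)` and `δ • y` agree on the rows `a`; injectivity of `P` then makes
  -- them equal, after multiplication by `c` to land in the image.
  set z := (X.submatrix a b).adjugate.mulVec (y ∘ a) with hz
  have hcy : c • y ∈ LinearMap.range ψ := (hex _).mp (by rw [map_smul, hcx])
  have hdiff : c • (δ • y - ψ (E z)) ∈ LinearMap.range ψ := by
    rw [smul_sub, smul_comm]
    exact sub_mem (Submodule.smul_mem _ _ hcy) (Submodule.smul_mem _ _ ⟨_, rfl⟩)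
  have hzero : (⟨_, hdiff⟩ : LinearMap.range ψ) ∈ LinearMap.ker P := by
    rw [LinearMap.mem_ker]
    change LinearMap.funLeft R R a (c • (δ • y - ψ (E z))) = 0
    rw [map_smul, map_sub, map_smul]
    have h := hPadj (y ∘ a)
    change LinearMap.funLeft R R a (ψ (E z)) = δ • (y ∘ a) at h
    rw [h]
    change c • (δ • (y ∘ a) - δ • (y ∘ a)) = 0
    rw [sub_self, smul_zero]
  rw [hker, Submodule.mem_bot, Submodule.mk_eq_zero, smul_eq_zero_iff_right hc, sub_eq_zero] at hzero
  rw [← map_smul, hzero]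
  exact hex.apply_apply_eq_zero _

/-- A finitely generated torsion-free module of rank one over a domain is isomorphic to an ideal. -/
theorem Module.exists_linearEquiv_ideal_of_finrank_eq_one {R N : Type*} [CommRing R] [IsDomain R]
    [AddCommGroup N] [Module R N] [Module.Finite R N] [Module.IsTorsionFree R N]
    (h : Module.finrank R N = 1) : ∃ I : Ideal R, Nonempty (N ≃ₗ[R] I) := by
  have : Nontrivial N := Module.nontrivial_of_finrank_pos (R := R) (by omega)
  obtain ⟨x, hx⟩ := exists_ne (0 : N)
  have hspan : Module.finrank R (R ∙ x) = 1 := by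
    rw [← (LinearEquiv.toSpanNonzeroSingleton R N x hx).finrank_eq, Module.finrank_self]
  have hquot : Module.finrank R (N ⧸ (R ∙ x)) = 0 := by
    have := (R ∙ x).finrank_quotient_add_finrank
    omega
  rw [Module.finrank_eq_zero_iff_isTorsion] at hquot
  -- One `c` kills the finitely generated torsion module `N / Rx`; multiplication by `c` embeds `N`
  -- into `Rx ≅ R`.
  obtain ⟨c, hc0, hc⟩ : ∃ c : R, c ≠ 0 ∧ ∀ y : N, c • y ∈ R ∙ x := by
    have hann := (Submodule.annihilator_top_inter_nonZeroDivisors (R := R) hquot)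
    obtain ⟨c, hc, hc'⟩ := hann
    refine ⟨c, nonZeroDivisors.ne_zero hc', fun y => ?_⟩
    have := Submodule.mem_annihilator.mp hc ((R ∙ x).mkQ y) trivial
    rwa [← map_smul, Submodule.mkQ_apply, Submodule.Quotient.mk_eq_zero] at this
  let f : N →ₗ[R] R := (LinearEquiv.toSpanNonzeroSingleton R N x hx).symm.toLinearMap ∘ₗ
    LinearMap.codRestrict (R ∙ x) (c • LinearMap.id) hc
  have hf : Function.Injective f := fun y z hyz => by
    have := congrArg Subtype.val
      ((LinearEquiv.toSpanNonzeroSingleton R N x hx).symm.injective hyz)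
    exact smul_right_injective N hc0 this
  exact ⟨LinearMap.range f, ⟨LinearEquiv.ofInjective f hf⟩⟩

/-! ### Localizing the presentation -/

theorem LinearMap.toMatrix'_map_mulVecLin_comp {R A m n : Type*} [CommRing R] [CommRing A]
    [Fintype n] [DecidableEq n] (ρ : R →+* A) (ψ : (n → R) →ₗ[R] (m → R)) (z : n → R) :
    ((LinearMap.toMatrix' ψ).map ρ).mulVecLin (ρ ∘ z) = ρ ∘ ψ z := by
  ext j
  rw [Matrix.mulVecLin_apply, ← RingHom.map_mulVec, LinearMap.toMatrix'_mulVec]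
  rfl

/-- Base change of a map between finite free modules to a localization of a domain: if the cokernel
is torsion-free, then the column space of the localized matrix is saturated. -/
theorem mem_range_mulVecLin_map_of_smul_mem {R : Type*} [CommRing R] [IsDomain R]
    {S : Submonoid R} (hS : S ≤ nonZeroDivisors R) (A : Type*) [CommRing A] [Algebra R A]
    [IsLocalization S A] {n m : ℕ} {N : Type*} [AddCommGroup N] [Module R N]
    [Module.IsTorsionFree R N] {ψ : (Fin n → R) →ₗ[R] (Fin m → R)} {π : (Fin m → R) →ₗ[R] N}
    (hex : Function.Exact ψ π) {c : A} {y : Fin m → A} (hc : c ≠ 0)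
    (hy : c • y ∈ LinearMap.range ((LinearMap.toMatrix' ψ).map (algebraMap R A)).mulVecLin) :
    y ∈ LinearMap.range ((LinearMap.toMatrix' ψ).map (algebraMap R A)).mulVecLin := by
  have hinj : Function.Injective (algebraMap R A) := IsLocalization.injective A hS
  have hmap : ∀ z : Fin n → R, ((LinearMap.toMatrix' ψ).map (algebraMap R A)).mulVecLin
      (algebraMap R A ∘ z) = algebraMap R A ∘ ψ z := 
    LinearMap.toMatrix'_map_mulVecLin_comp _ ψ
  obtain ⟨z, hz⟩ := hy
  obtain ⟨q₁, hq₁⟩ := IsLocalization.exist_integer_multiples_of_finite S y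
  obtain ⟨q₂, hq₂⟩ := IsLocalization.exist_integer_multiples_of_finite S z
  obtain ⟨q₃, c', hc'⟩ := IsLocalization.exists_integer_multiple S c
  choose y' hy' using hq₁
  choose z' hz' using hq₂
  simp only [Algebra.smul_def] at hy' hz' hc'
  have hne : ∀ q : S, (q : R) ≠ 0 := fun q => nonZeroDivisors.ne_zero (hS q.2)
  have hc0 : c' ≠ 0 := by
    rintro rfl
    rw [map_zero, eq_comm, (IsLocalization.map_units A q₃).mul_right_eq_zero] at hc'
    exact hc hc'
  have hy'' : algebraMap R A ∘ y' = algebraMap R A q₁ • y := funext hy'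
  have hz'' : algebraMap R A ∘ z' = algebraMap R A q₂ • z := funext hz'
  -- The relation `X z = c y` with denominators cleared; it makes `π y'` torsion.
  have hkey : ((q₂ : R) * c') • y' = ((q₁ : R) * q₃) • ψ z' := by
    have h1 := hmap z'
    rw [hz'', map_smul, hz] at h1
    ext j
    apply hinj
    have h2 := congrFun h1 j
    simp only [Pi.smul_apply, smul_eq_mul, Function.comp_apply, map_mul] at h2 ⊢
    rw [hc', hy' j, ← h2]
    ring
  have hπ : π y' = 0 := by
    have h3 := congrArg π hkey
    rw [map_smul, map_smul, hex.apply_apply_eq_zero, smul_zero] at h3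
    exact (smul_eq_zero_iff_right (mul_ne_zero (hne q₂) hc0)).mp h3
  obtain ⟨w, hw⟩ := (hex _).mp hπ
  obtain ⟨e, he⟩ := (IsLocalization.map_units A q₁).exists_left_inv
  refine ⟨e • (algebraMap R A ∘ w), ?_⟩
  rw [map_smul, hmap, hw, hy'', smul_smul, he, one_smul]

/-- If the cokernel of `ψ` is torsion-free over a Noetherian normal domain, then the minors of `ψ`
of maximal nonvanishing size generate an ideal of height at least two. -/
theorem two_le_height_minorsIdeal {R : Type u} [CommRing R] [IsDomain R]
    [IsNoetherianRing R] [IsIntegrallyClosed R] {n m k : ℕ} {N : Type*} [AddCommGroup N]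
    [Module R N] [Module.IsTorsionFree R N] {ψ : (Fin n → R) →ₗ[R] (Fin m → R)}
    {π : (Fin m → R) →ₗ[R] N} (hex : Function.Exact ψ π)
    (hk : Module.finrank R (LinearMap.range ψ) = k) : 2 ≤ (minorsIdeal k ψ).height := by
  -- The unit ideal has no minimal primes, so its height is `⊤`.
  rw [Ideal.height_eq_inf_minimalPrimes]
  refine le_iInf₂ fun p hp => ?_
  have hprime : p.IsPrime := hp.1.1
  by_contra hlt
  have hp1 : p.height ≤ 1 := by
    rw [not_le, ← one_add_one_eq_two] at hlt
    exact Order.le_of_lt_add_one hlt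
  let A := Localization.AtPrime p
  have hpid : IsPrincipalIdealRing A := p.isPrincipalIdealRing_localization_of_height_le_one hp1
  have hle : p.primeCompl ≤ nonZeroDivisors R := p.primeCompl_le_nonZeroDivisors
  have hdom : IsDomain A := IsLocalization.isDomain_localization hle
  obtain ⟨v, hv⟩ := exists_linearIndependent_of_le_finrank hk.ge
  let f : (Fin m → R) →ₗ[R] (Fin m → A) :=
    LinearMap.pi fun i => Algebra.linearMap R A ∘ₗ LinearMap.proj i
  have hv' : LinearIndependent A (fun i => f (v i)) :=
    (hv.map' (LinearMap.range ψ).subtype (Submodule.ker_subtype _)).of_isLocalizedModule A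
      p.primeCompl f
  have hmem : ∀ i, f (v i) ∈
      LinearMap.range ((LinearMap.toMatrix' ψ).map (algebraMap R A)).mulVecLin := fun i => by
    obtain ⟨z, hz⟩ := (v i).2
    refine ⟨algebraMap R A ∘ z, ?_⟩
    rw [LinearMap.toMatrix'_map_mulVecLin_comp, hz]
    rfl
  obtain ⟨a, b, hab⟩ := Matrix.exists_isUnit_det_submatrix_of_saturated
    ((LinearMap.toMatrix' ψ).map (algebraMap R A))
    (fun c y hc hy => mem_range_mulVecLin_map_of_smul_mem hle A hex hc hy)
    (fun i => ⟨f (v i), hmem i⟩)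
    (LinearIndependent.of_comp (Submodule.subtype _) hv')
  have hdet : IsUnit (algebraMap R A ((LinearMap.toMatrix' ψ).submatrix a b).det) := by
    rw [RingHom.map_det]
    exact hab
  exact (IsLocalization.AtPrime.isUnit_to_map_iff A p _).mp hdet
    (hp.1.2 (Ideal.subset_span ⟨a, b, rfl⟩))

/-! ### The criterion and Bourbaki sequences -/

/-- Let `N` be presented by `ψ`, and suppose that `N` is a quotient of a torsion-free module by a
finite free submodule. If the minors of `ψ` of size `rank ψ` generate an ideal of height at least
two, then `N` is torsion-free. -/
theorem isTorsionFree_of_two_le_height_minorsIdeal {R : Type u} [CommRing R] [IsDomain R]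
    [IsNoetherianRing R] [IsIntegrallyClosed R] {n m k : ℕ} {N : Type*} [AddCommGroup N]
    [Module R N] {ψ : (Fin n → R) →ₗ[R] (Fin m → R)} {π : (Fin m → R) →ₗ[R] N}
    (hex : Function.Exact ψ π) (hπ : Function.Surjective π)
    (hk : Module.finrank R (LinearMap.range ψ) = k) {ι M : Type*} [AddCommGroup M] [Module R M]
    [Module.IsTorsionFree R M] {φ : (ι → R) →ₗ[R] M} {g : M →ₗ[R] N}
    (hφ : Function.Injective φ) (hφg : Function.Exact φ g) (hg : Function.Surjective g)
    (hht : 2 ≤ (minorsIdeal k ψ).height) : Module.IsTorsionFree R N := by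
  refine Module.IsTorsionFree.of_smul_eq_zero fun c x hcx => or_iff_not_imp_left.mpr fun hc => ?_
  exact eq_zero_of_two_le_height_torsionOf hφ hφg hg
    (hht.trans (Ideal.height_mono (minorsIdeal_le_torsionOf hex hπ hk hc hcx)))

theorem theorem4p3 {R : Type u} [CommRing R] [IsDomain R] [IsNoetherianRing R]
    [IsIntegrallyClosed R] (hdim : 2 ≤ ringKrullDim R) :
    -- parts (a) and (b): `N` has rank `s` and the presentation `R^β₁ → R^β₀ → N → 0`
    (∀ (N : Type u) [AddCommGroup N] [Module R N] (s β₁ β₀ : ℕ)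
        (ψ : (Fin β₁ → R) →ₗ[R] (Fin β₀ → R)) (π : (Fin β₀ → R) →ₗ[R] N),
        Module.finrank R N = s → Function.Exact ψ π → Function.Surjective π →
        (Module.IsTorsionFree R N → 2 ≤ (minorsIdeal (β₀ - s) ψ).height) ∧
        (∀ (M : Type u) [AddCommGroup M] [Module R M] (t : ℕ)
          (φ : (Fin t → R) →ₗ[R] M) (g : M →ₗ[R] N),
          Function.Injective φ → Function.Exact φ g → Function.Surjective g →
          Module.IsTorsionFree R M → HasFiniteProjDim R M →
          2 ≤ (minorsIdeal (β₀ - s) ψ).height → Module.IsTorsionFree R N)) ∧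
    -- the corollary on Bourbaki sequences
    (∀ (M : Type u) [AddCommGroup M] [Module R M] [Module.Finite R M] (r β₁ β₀ : ℕ)
        (φ : (Fin (r - 1) → R) →ₗ[R] M)
        (ψ : (Fin β₁ → R) →ₗ[R] (Fin β₀ → R))
        (π : (Fin β₀ → R) →ₗ[R] (M ⧸ LinearMap.range φ)),
        Module.IsTorsionFree R M → Module.finrank R M = r → 1 < r → HasFiniteProjDim R M →
        Function.Injective φ → Function.Exact ψ π → Function.Surjective π →
        (Module.IsTorsionFree R (M ⧸ LinearMap.range φ) ↔
          2 ≤ (minorsIdeal (β₀ - 1) ψ).height) ∧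
        (IsBourbakiSequence φ (LinearMap.range φ).mkQ ↔
          2 ≤ (minorsIdeal (β₀ - 1) ψ).height)) := by
  refine ⟨fun N _ _ s β₁ β₀ ψ π hs hex hπ => ?_, fun M _ _ _ r β₁ β₀ φ ψ π htf hr hr1 _ hφ hex hπ => ?_⟩
  · have hk := finrank_range_of_exact hex hπ
    rw [hs] at hk
    exact ⟨fun _ => two_le_height_minorsIdeal hex hk, fun M _ _ t φ g hφ hφg hg _ _ hht =>
      isTorsionFree_of_two_le_height_minorsIdeal hex hπ hk hφ hφg hg hht⟩
  · have hs : Module.finrank R (M ⧸ LinearMap.range φ) = 1 := by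
      have h := (LinearMap.range φ).finrank_quotient_add_finrank
      rw [LinearMap.finrank_range_of_inj hφ, Module.finrank_fin_fun] at h
      -- Since `1 < r`, the rank is `r - (r - 1) = 1`.
      omega
    have hk := finrank_range_of_exact hex hπ
    rw [hs] at hk
    have hφg : Function.Exact φ (LinearMap.range φ).mkQ := LinearMap.exact_map_mkQ_range φ
    have hg := (LinearMap.range φ).mkQ_surjective
    have hiff : Module.IsTorsionFree R (M ⧸ LinearMap.range φ) ↔
        2 ≤ (minorsIdeal (β₀ - 1) ψ).height :=
      ⟨fun _ => two_le_height_minorsIdeal hex hk,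
        isTorsionFree_of_two_le_height_minorsIdeal hex hπ hk hφ hφg hg⟩
    refine ⟨hiff, ?_⟩
    rw [← hiff]
    refine ⟨fun h => ?_, fun _ => ⟨inferInstance, hφ, hφg, hg,
      Module.exists_linearEquiv_ideal_of_finrank_eq_one hs⟩⟩
    -- Ideals of a domain are torsion-free.
    obtain ⟨I, ⟨e⟩⟩ := h.iso_ideal
    exact e.injective.moduleIsTorsionFree e e.map_smul
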